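/- Let $n\ge 0$, let $Q^0,Q^1\in\mathbb S^n$ be real symmetric matrices, $q_0,q_1\in\mathbb R^n$, $b_1\in\mathbb R$, and put $$\bar Q^0=\begin{bmatrix}0&q_0^T\\ q_0&Q^0\end{bmatrix},\qquad \bar Q^1=\begin{bmatrix}-b_1&q_1^T\\ q_1&Q^1\end{bmatrix},$$ and let $E_{11}$ be the $(n+1)\times(n+1)$ matrix whose only nonzero entry is a $1$ in position $(1,1)$. Consider the homogenized generalized trust-region subproblem $$\min_{x\in\mathbb R^{n+1}} x^T\bar Q^0x\quad\text{subject to}\quad x^T\bar Q^1x\le 0,\quad x^TE_{11}x=1, \tag{P}$$ the equality being regarded as the two inequalities $x^TE_{11}x\le 1$ and $-x^TE_{11}x\le -1$, and its SDP relaxation $$\min_{X\in\mathbb S^{n+1}} \langle\bar Q^0,X\rangle\quad\text{subject to}\quad \langle\bar Q^1,X\rangle\le 0,\quad \langle E_{11},X\rangle=1,\quad X\succeq O, \tag{R}$$ where $\langle M,N\rangle=\operatorname{trace}(M^TN)$. Assume that (a) (P) has a feasible point; (b) there are $y_1,y_2,y_3\ge 0$ such that $y_1\bar Q^1+y_2E_{11}-y_3E_{11}\succ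 O$; (c) (R) has an interior feasible point, that is, a feasible point $X$ with $X\succ O$. Then the SDP relaxation is exact: (R) has an optimal solution $X^*$ of rank one, of the form $X^*=x^*(x^*)^T$, where $x^*$ is an optimal solution of (P) (so both optimal values are attained and equal). -/

import Mathlib

open scoped Matrix

noncomputable section

/-- Data of a homogeneous QCQP in real variables indexed by `ι`, with inequality constraints indexed
by `κ`: minimise `xᵀ Q0 x` subject to `xᵀ (Q p) x ≤ b p` for every `p : κ`. -/
structure HomQCQP (ι κ : Type) where
  /-- matrix of the objective -/
  Q0 : Matrix ι ι ℝ
  /-- matrices of the constraints -/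
  Q : κ → Matrix ι ι ℝ
  /-- right-hand sides of the constraints -/
  b : κ → ℝ

/-- The Frobenius inner product `trace (Mᵀ N)`. -/
def frobInner {ι : Type} [Fintype ι] (M N : Matrix ι ι ℝ) : ℝ :=
  (Mᵀ * N).trace

namespace HomQCQP

variable {ι κ : Type} [Fintype ι]

/-- `x` is a feasible point of the QCQP. -/
def Feasible (P : HomQCQP ι κ) (x : ι → ℝ) : Prop :=
  ∀ p, x ⬝ᵥ (P.Q p *ᵥ x) ≤ P.b p

/-- `x` is an optimal solution of the QCQP. -/
def Optimal (P : HomQCQP ι κ) (x : ι → ℝ) : Prop :=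
  P.Feasible x ∧ ∀ z, P.Feasible z → x ⬝ᵥ (P.Q0 *ᵥ x) ≤ z ⬝ᵥ (P.Q0 *ᵥ z)

/-- `X` is a feasible point of the SDP relaxation: minimise `⟨Q0, X⟩` subject to
`⟨Q p, X⟩ ≤ b p` for every `p : κ` and `X ⪰ O`. -/
def SDPFeasible (P : HomQCQP ι κ) (X : Matrix ι ι ℝ) : Prop :=
  X.PosSemidef ∧ ∀ p, frobInner (P.Q p) X ≤ P.b p

/-- `X` is an optimal solution of the SDP relaxation. -/
def SDPOptimal (P : HomQCQP ι κ) (X : Matrix ι ι ℝ) : Prop :=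
  P.SDPFeasible X ∧ ∀ Z, P.SDPFeasible Z → frobInner P.Q0 X ≤ frobInner P.Q0 Z

/-- The standing assumptions on a QCQP: it has a feasible point, some nonnegative combination of
the constraint matrices is positive definite, and the SDP relaxation has a feasible point in the
interior of the positive semidefinite cone. (Equality constraints, written as pairs of opposite
inequalities, are allowed, so the linear inequalities are not required to hold strictly.) -/
structure StandingAssumption [Fintype κ] (P : HomQCQP ι κ) : Prop where
  feasible : ∃ x, P.Feasible x
  posDef_combination : ∃ y : κ → ℝ, (∀ p, 0 ≤ y p) ∧ (∑ p, y p • P.Q p).PosDef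
  interior_feasible : ∃ X, P.SDPFeasible X ∧ X.PosDef

/-- The SDP relaxation is exact: it has an optimal solution of rank one, of the form `x xᵀ`
where `x` is an optimal solution of the QCQP. -/
def SDPExact (P : HomQCQP ι κ) : Prop :=
  ∃ X, P.SDPOptimal X ∧ X.rank = 1 ∧ ∃ x, X = Matrix.vecMulVec x x ∧ P.Optimal x

end HomQCQP

/-- The bordered matrix with blocks `-b`, `qᵀ`, `q`, `Q`; the index `Sum.inl 0` is the added
first coordinate. -/
def borderedMatrix {n : ℕ} (Q : Matrix (Fin n) (Fin n) ℝ) (q : Fin n → ℝ) (b : ℝ) :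
    Matrix (Fin 1 ⊕ Fin n) (Fin 1 ⊕ Fin n) ℝ :=
  Matrix.fromBlocks (Matrix.of fun _ _ => -b) (Matrix.replicateRow (Fin 1) q)
    (Matrix.replicateCol (Fin 1) q) Q

/-- The matrix `E₁₁` whose only nonzero entry is a `1` at the first diagonal place. -/
def cornerMatrix (n : ℕ) : Matrix (Fin 1 ⊕ Fin n) (Fin 1 ⊕ Fin n) ℝ :=
  Matrix.single (Sum.inl 0) (Sum.inl 0) 1

/-- The homogenised generalised trust-region subproblem: the homogenisation of
minimising `xᵀ Q0 x + 2 q0ᵀ x` subject to `xᵀ Q1 x + 2 q1ᵀ x ≤ b1`. The equality constraint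
`zᵀ E₁₁ z = 1` is written as the two inequalities `zᵀ E₁₁ z ≤ 1` and `zᵀ (-E₁₁) z ≤ -1`. -/
def homGTRS {n : ℕ} (Q0 Q1 : Matrix (Fin n) (Fin n) ℝ) (q0 q1 : Fin n → ℝ) (b1 : ℝ) :
    HomQCQP (Fin 1 ⊕ Fin n) (Fin 3) where
  Q0 := borderedMatrix Q0 q0 0
  Q := ![borderedMatrix Q1 q1 b1, cornerMatrix n, -cornerMatrix n]
  b := ![0, 1, -1]

end

open Matrix

section QuadraticForms

variable {ι : Type} [Fintype ι]

/-! The positive definite combination makes the feasible set of (P) compact, so an optimal `x` with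
value `p` exists. By homogeneity, `F - p E₁₁` is nonnegative on every vector where `G` is
nonpositive (`F`, `G` being the bordered objective and constraint matrices). With a single
constraint form `G`, this implication passes from vectors to positive semidefinite matrices
(`frobInner_nonneg_of_nonpos`): a decomposition into rank-one terms can be rotated, two vectors at a
time, until each term satisfies `G ≤ 0`. Since `⟨E₁₁, Z⟩ = 1`, it follows that `⟨F, Z⟩ ≥ p` for
every feasible `Z` of (R), and `x xᵀ` attains this bound. -/

theorem dotProduct_mulVec_smul_add_smul (M : Matrix ι ι ℝ) (c s : ℝ) (x y : ι → ℝ) :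
    (c • x + s • y) ⬝ᵥ (M *ᵥ (c • x + s • y)) =
      c ^ 2 * (x ⬝ᵥ (M *ᵥ x)) + c * s * (x ⬝ᵥ (M *ᵥ y) + y ⬝ᵥ (M *ᵥ x)) +
        s ^ 2 * (y ⬝ᵥ (M *ᵥ y)) := by
  simp only [mulVec_add, mulVec_smul, dotProduct_add, add_dotProduct, smul_dotProduct,
    dotProduct_smul, smul_eq_mul]
  ring

theorem dotProduct_mulVec_smul_smul (M : Matrix ι ι ℝ) (c : ℝ) (x : ι → ℝ) :
    (c • x) ⬝ᵥ (M *ᵥ (c • x)) = c ^ 2 * (x ⬝ᵥ (M *ᵥ x)) := by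
  simp only [mulVec_smul, smul_dotProduct, dotProduct_smul, smul_eq_mul]
  ring

/-- A rotation in the plane of two vectors preserves the sum of the values of a quadratic form. -/
theorem dotProduct_mulVec_rotation (M : Matrix ι ι ℝ) {c s : ℝ} (hcs : c ^ 2 + s ^ 2 = 1)
    (x y : ι → ℝ) :
    (c • x + s • y) ⬝ᵥ (M *ᵥ (c • x + s • y)) +
        ((-s) • x + c • y) ⬝ᵥ (M *ᵥ ((-s) • x + c • y)) =
      x ⬝ᵥ (M *ᵥ x) + y ⬝ᵥ (M *ᵥ y) := by
  rw [dotProduct_mulVec_smul_add_smul, dotProduct_mulVec_smul_add_smul]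
  linear_combination (x ⬝ᵥ (M *ᵥ x) + y ⬝ᵥ (M *ᵥ y)) * hcs

/-- Intermediate value theorem along the quarter turn from `x` to `y`. -/
theorem exists_rotation_isotropic (G : Matrix ι ι ℝ) {x y : ι → ℝ}
    (hx : 0 ≤ x ⬝ᵥ (G *ᵥ x)) (hy : y ⬝ᵥ (G *ᵥ y) ≤ 0) :
    ∃ c s : ℝ, c ^ 2 + s ^ 2 = 1 ∧ (c • x + s • y) ⬝ᵥ (G *ᵥ (c • x + s • y)) = 0 := by
  have hcont : Continuous fun θ : ℝ =>
      (Real.cos θ • x + Real.sin θ • y) ⬝ᵥ (G *ᵥ (Real.cos θ • x + Real.sin θ • y)) := by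
    simp only [dotProduct_mulVec_smul_add_smul]
    fun_prop
  obtain ⟨θ, -, hθ⟩ := intermediate_value_Icc' (by positivity : (0 : ℝ) ≤ Real.pi / 2)
    hcont.continuousOn (show (0 : ℝ) ∈ _ by simpa using ⟨hy, hx⟩)
  exact ⟨Real.cos θ, Real.sin θ, Real.cos_sq_add_sin_sq θ, hθ⟩

/-- If a quadratic form is nonnegative wherever another one is nonpositive, the same implication
holds for the sums of their values over a finite family of vectors. -/
theorem sum_nonneg_of_sum_nonpos {α : Type*} [DecidableEq α] (G H : Matrix ι ι ℝ)
    (hGH : ∀ x, x ⬝ᵥ (G *ᵥ x) ≤ 0 → 0 ≤ x ⬝ᵥ (H *ᵥ x)) (s : Finset α) (v : α → ι → ℝ)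
    (hs : ∑ i ∈ s, v i ⬝ᵥ (G *ᵥ v i) ≤ 0) : 0 ≤ ∑ i ∈ s, v i ⬝ᵥ (H *ᵥ v i) := by
  induction hn : s.card generalizing s v with
  | zero => simp [Finset.card_eq_zero.mp hn]
  | succ m ih =>
    by_cases hall : ∀ i ∈ s, v i ⬝ᵥ (G *ᵥ v i) ≤ 0
    · exact Finset.sum_nonneg fun i hi => hGH _ (hall i hi)
    push Not at hall
    obtain ⟨i, hi, hpos⟩ := hall
    obtain ⟨j, hj, hneg⟩ : ∃ j ∈ s, v j ⬝ᵥ (G *ᵥ v j) < 0 := by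
      by_contra! hcon
      exact absurd (Finset.sum_pos' hcon ⟨i, hi, hpos⟩) hs.not_gt
    have hij : j ≠ i := by
      rintro rfl
      exact lt_asymm hneg hpos
    have hj' : j ∈ s.erase i := Finset.mem_erase.mpr ⟨hij, hj⟩
    obtain ⟨c, t, hct, h0⟩ := exists_rotation_isotropic G hpos.le hneg.le
    -- The pair `v i`, `v j` is rotated so that one vector is isotropic for `G`. That vector is
    -- split off; its partner takes slot `j`. All sums are preserved, and the remaining family is
    -- smaller by one with the same `G`-sum.
    set w : α → ι → ℝ := Function.update v j ((-t) • v i + c • v j) with hw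
    have key : ∀ M : Matrix ι ι ℝ, ∑ k ∈ s, v k ⬝ᵥ (M *ᵥ v k) =
        (c • v i + t • v j) ⬝ᵥ (M *ᵥ (c • v i + t • v j)) +
          ∑ k ∈ s.erase i, w k ⬝ᵥ (M *ᵥ w k) := by
      intro M
      rw [← Finset.add_sum_erase _ _ hi, ← Finset.add_sum_erase _ _ hj',
        ← Finset.add_sum_erase (s.erase i) (fun k => w k ⬝ᵥ (M *ᵥ w k)) hj',
        ← add_assoc, ← add_assoc, ← dotProduct_mulVec_rotation M hct]
      congr 1
      · simp [hw]
      · refine Finset.sum_congr rfl fun k hk => ?_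
        rw [hw, Function.update_of_ne (Finset.ne_of_mem_erase hk)]
    rw [key H]
    refine add_nonneg (hGH _ h0.le) (ih _ _ ?_ ?_)
    · simpa [key G, h0] using hs
    · rw [Finset.card_erase_of_mem hi, hn, Nat.add_sub_cancel]

open scoped MatrixOrder Matrix.Norms.L2Operator in
theorem Matrix.PosSemidef.exists_eq_transpose_mul_self {X : Matrix ι ι ℝ} (hX : X.PosSemidef) :
    ∃ B : Matrix ι ι ℝ, X = Bᵀ * B := by
  classical
  obtain ⟨B, rfl⟩ := CStarAlgebra.nonneg_iff_eq_star_mul_self.mp hX.nonneg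
  exact ⟨B, by rw [star_eq_conjTranspose, conjTranspose_eq_transpose_of_trivial]⟩

/-- `Bᵀ * B` is the sum of the rank-one matrices built from the rows `B i`. -/
theorem frobInner_transpose_mul_self (M B : Matrix ι ι ℝ) :
    frobInner M (Bᵀ * B) = ∑ i, B i ⬝ᵥ (M *ᵥ B i) := by
  rw [frobInner, Matrix.trace_mul_comm, Matrix.mul_assoc, Matrix.trace_mul_comm,
    ← Matrix.trace_transpose]
  simp only [transpose_mul, transpose_transpose, trace, diag_apply, mul_apply, dotProduct, mulVec,
    transpose_apply]

theorem frobInner_vecMulVec_self (M : Matrix ι ι ℝ) (x : ι → ℝ) :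
    frobInner M (vecMulVec x x) = x ⬝ᵥ (M *ᵥ x) := by
  rw [frobInner, mul_vecMulVec, trace_vecMulVec, mulVec_transpose, ← dotProduct_mulVec]

/-- The implication between quadratic forms extends from vectors to positive semidefinite
matrices. -/
theorem frobInner_nonneg_of_nonpos (G H : Matrix ι ι ℝ)
    (hGH : ∀ x, x ⬝ᵥ (G *ᵥ x) ≤ 0 → 0 ≤ x ⬝ᵥ (H *ᵥ x)) {X : Matrix ι ι ℝ} (hX : X.PosSemidef)
    (hGX : frobInner G X ≤ 0) : 0 ≤ frobInner H X := by
  classical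
  obtain ⟨B, rfl⟩ := hX.exists_eq_transpose_mul_self
  rw [frobInner_transpose_mul_self] at *
  exact sum_nonneg_of_sum_nonpos G H hGH _ _ hGX

theorem continuous_dotProduct_mulVec_self (M : Matrix ι ι ℝ) :
    Continuous fun x : ι → ℝ => x ⬝ᵥ (M *ᵥ x) := by
  simp only [dotProduct, mulVec]
  fun_prop

theorem Matrix.PosDef.isCompact_sublevel {B : Matrix ι ι ℝ} (hB : B.PosDef) (c : ℝ) :
    IsCompact {x : ι → ℝ | x ⬝ᵥ (B *ᵥ x) ≤ c} := by
  classical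
  obtain ⟨C, hC, rfl⟩ : ∃ C : Matrix ι ι ℝ, IsUnit C ∧ B = Cᵀ * C := by
    obtain ⟨C, rfl⟩ := hB.posSemidef.exists_eq_transpose_mul_self
    exact ⟨C, isUnit_of_mul_isUnit_right hB.isUnit, rfl⟩
  -- The form is the sum of squares of the entries of `C *ᵥ x`, so each entry is at most `√c` in
  -- absolute value: a sup-norm ball.
  have hball : IsCompact (Metric.closedBall (0 : ι → ℝ) (Real.sqrt c)) :=
    isCompact_closedBall _ _
  refine (hball.image (f := fun y => C⁻¹ *ᵥ y) (by fun_prop)).of_isClosed_subset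
    (isClosed_le (continuous_dotProduct_mulVec_self _) continuous_const) fun x hx => ?_
  refine ⟨C *ᵥ x, ?_, ?_⟩
  · rw [Set.mem_ofPred_eq, ← mulVec_mulVec, dotProduct_mulVec, vecMul_transpose] at hx
    rw [mem_closedBall_zero_iff, pi_norm_le_iff_of_nonneg (Real.sqrt_nonneg _)]
    intro i
    refine Real.abs_le_sqrt (le_trans ?_ hx)
    rw [sq]
    exact Finset.single_le_sum (f := fun i => (C *ᵥ x) i * (C *ᵥ x) i)
      (fun j _ => mul_self_nonneg _) (Finset.mem_univ i)
  · simp [mulVec_mulVec, nonsing_inv_mul _ ((isUnit_iff_isUnit_det _).mp hC)]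

theorem rank_vecMulVec_self {x : ι → ℝ} (hx : x ≠ 0) : (vecMulVec x x).rank = 1 := by
  refine le_antisymm (rank_vecMulVec_le _ _) (Nat.one_le_iff_ne_zero.mpr fun h => hx ?_)
  rw [Matrix.rank, Submodule.finrank_eq_zero, LinearMap.range_eq_bot] at h
  have h0 : vecMulVec x x *ᵥ x = 0 := LinearMap.congr_fun h x
  rw [vecMulVec_mulVec] at h0
  simpa using h0

end QuadraticForms

namespace HomQCQP

variable {ι κ : Type} [Fintype ι]

theorem Feasible.dotProduct_sum_smul_le [Fintype κ] {P : HomQCQP ι κ} {x : ι → ℝ}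
    (hx : P.Feasible x) {y : κ → ℝ} (hy : ∀ p, 0 ≤ y p) :
    x ⬝ᵥ ((∑ p, y p • P.Q p) *ᵥ x) ≤ ∑ p, y p * P.b p := by
  rw [sum_mulVec, dotProduct_sum]
  refine Finset.sum_le_sum fun p _ => ?_
  rw [smul_mulVec, dotProduct_smul, smul_eq_mul]
  exact mul_le_mul_of_nonneg_left (hx p) (hy p)

/-- A feasible QCQP whose constraint matrices have a positive definite nonnegative combination
attains its minimum. -/
theorem StandingAssumption.exists_optimal [Fintype κ] {P : HomQCQP ι κ}
    (h : P.StandingAssumption) : ∃ x, P.Optimal x := by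
  obtain ⟨y, hy, hB⟩ := h.posDef_combination
  have hclosed : IsClosed {x | P.Feasible x} := by
    simp only [Feasible, Set.ofPred_forall]
    exact isClosed_iInter fun p =>
      isClosed_le (continuous_dotProduct_mulVec_self _) continuous_const
  have hcomp : IsCompact {x | P.Feasible x} :=
    (hB.isCompact_sublevel _).of_isClosed_subset hclosed
      fun _ hx => Feasible.dotProduct_sum_smul_le hx hy
  obtain ⟨x, hx, hmin⟩ := hcomp.exists_isMinOn h.feasible
    (continuous_dotProduct_mulVec_self P.Q0).continuousOn
  exact ⟨x, hx, fun z hz => hmin hz⟩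

theorem Feasible.sdpFeasible {P : HomQCQP ι κ} {x : ι → ℝ} (hx : P.Feasible x) :
    P.SDPFeasible (vecMulVec x x) :=
  ⟨by simpa using posSemidef_vecMulVec_self_star x, fun p => by
    rw [frobInner_vecMulVec_self]; exact hx p⟩

end HomQCQP

section CornerMatrix

variable {n : ℕ}

theorem dotProduct_cornerMatrix_mulVec (x : Fin 1 ⊕ Fin n → ℝ) :
    x ⬝ᵥ (cornerMatrix n *ᵥ x) = x (Sum.inl 0) ^ 2 := by
  rw [cornerMatrix, single_mulVec, ← Pi.single, dotProduct_single]
  ring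

theorem homGTRS_feasible_iff {Q0 Q1 : Matrix (Fin n) (Fin n) ℝ} {q0 q1 : Fin n → ℝ} {b1 : ℝ}
    {x : Fin 1 ⊕ Fin n → ℝ} :
    (homGTRS Q0 Q1 q0 q1 b1).Feasible x ↔
      x ⬝ᵥ (borderedMatrix Q1 q1 b1 *ᵥ x) ≤ 0 ∧ x (Sum.inl 0) ^ 2 = 1 := by
  simp only [HomQCQP.Feasible, homGTRS, Fin.forall_fin_succ, le_antisymm_iff]
  simp [neg_mulVec, dotProduct_cornerMatrix_mulVec]

end CornerMatrix

theorem mainTheorem5 (n : ℕ) (Q0 Q1 : Matrix (Fin n) (Fin n) ℝ) (hQ0 : Q0.IsSymm)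
    (hQ1 : Q1.IsSymm) (q0 q1 : Fin n → ℝ) (b1 : ℝ)
    (h : (homGTRS Q0 Q1 q0 q1 b1).StandingAssumption) :
    (homGTRS Q0 Q1 q0 q1 b1).SDPExact := by
  obtain ⟨x, hx⟩ := h.exists_optimal
  obtain ⟨y, hy, hB⟩ := h.posDef_combination
  set G := borderedMatrix Q1 q1 b1 with hG
  set F := borderedMatrix Q0 q0 0 with hF
  set p := x ⬝ᵥ (F *ᵥ x) with hp
  have hform : ∀ z, z ⬝ᵥ ((F - p • cornerMatrix n) *ᵥ z) =
      z ⬝ᵥ (F *ᵥ z) - p * z (Sum.inl 0) ^ 2 := fun z => by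
    rw [sub_mulVec, smul_mulVec, dotProduct_sub, dotProduct_smul, smul_eq_mul,
      dotProduct_cornerMatrix_mulVec]
  have hGF : ∀ z, z ⬝ᵥ (G *ᵥ z) ≤ 0 → 0 ≤ z ⬝ᵥ ((F - p • cornerMatrix n) *ᵥ z) := by
    intro z hz
    by_cases ht : z (Sum.inl 0) = 0
    -- The `E₁₁` terms vanish at `z`, so the positive definite combination reduces to `y 0` times
    -- the `G`-value, which is nonpositive.
    · have hz0 : z = 0 := by
        by_contra hne
        have hpos := hB.dotProduct_mulVec_pos hne
        simp only [homGTRS, Fin.sum_univ_three, cons_val_zero, cons_val_one, cons_val,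
          star_trivial, add_mulVec, dotProduct_add, smul_mulVec, dotProduct_smul, smul_eq_mul,
          neg_mulVec, dotProduct_neg, dotProduct_cornerMatrix_mulVec, ht] at hpos
        have := mul_nonpos_of_nonneg_of_nonpos (hy 0) hz
        linarith
      simp [hz0]
    -- Scaling the first coordinate to `1` gives a feasible point, to which optimality of `x`
    -- applies.
    · have hfeas : (homGTRS Q0 Q1 q0 q1 b1).Feasible ((z (Sum.inl 0))⁻¹ • z) := by
        rw [homGTRS_feasible_iff, dotProduct_mulVec_smul_smul]
        refine ⟨mul_nonpos_of_nonneg_of_nonpos (sq_nonneg _) hz, ?_⟩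
        simp [ht]
      have hle : p ≤ _ := hx.2 _ hfeas
      rw [dotProduct_mulVec_smul_smul, inv_pow, inv_mul_eq_div, le_div_iff₀ (by positivity)] at hle
      rw [hform]
      exact sub_nonneg.mpr hle
  have hx1 := (homGTRS_feasible_iff.mp hx.1).2
  refine ⟨vecMulVec x x, ⟨hx.1.sdpFeasible, fun Z hZ => ?_⟩, rank_vecMulVec_self ?_, x, rfl, hx⟩
  · have h0 : frobInner G Z ≤ 0 := hZ.2 0
    have h2 : frobInner (-cornerMatrix n) Z ≤ -1 := hZ.2 2
    have h1 : frobInner (cornerMatrix n) Z ≤ 1 := hZ.2 1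
    have hnn := frobInner_nonneg_of_nonpos G _ hGF hZ.1 h0
    have hneg : frobInner (-cornerMatrix n) Z = -frobInner (cornerMatrix n) Z := by
      simp [frobInner]
    have hone : frobInner (cornerMatrix n) Z = 1 := by linarith
    have hsub : frobInner (F - p • cornerMatrix n) Z =
        frobInner F Z - p * frobInner (cornerMatrix n) Z := by
      simp [frobInner, Matrix.sub_mul]
    rw [frobInner_vecMulVec_self]
    change p ≤ frobInner F Z
    rw [hsub, hone] at hnn
    linarith
  · rintro rfl
    simp at hx1
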